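/- Let $X$ be a real locally convex space with topological dual $X^*$, and let $X^*$ be endowed with any locally convex topology compatible with the duality $(X^*,X)$ (for instance the weak-$*$ topology); closures in $X^*$ are taken with respect to it. For $f:X\to\mathbb{R}\cup\{\pm\infty\}$ write $[f\le 0]:=\{y\in X: f(y)\le 0\}$; let $\operatorname{cl} f=\bar f$ be the function whose epigraph is the closure in $X\times\mathbb{R}$ of the epigraph of $f$; call $f$ proper if it never takes the value $-\infty$ and is not identically $+\infty$; and for $\varepsilon\ge 0$ let $$\partial_\varepsilon f(x):=\{x^*\in X^*:\ \langle x^*,y-x\rangle\le f(y)-f(x)+\varepsilon\ \text{ for all } y\in X\}$$ if $f(x)\in\mathbb{R}$, and $\partial_\varepsilon f(x):=\emptyset$ otherwise. For $A\subset X$, let $\mathrm{N}_A(x):=\partial_0 \mathrm{I}_A(x)$ be the normal cone, where $\mathrm{I}_A$ is $0$ on $A$ and $+\infty$ off $A$. For a nonempty closed convex set $C\subset X^*$, let $[C]_\infty:=\bigcap_{t>0}t(C-c)$ (with $c\in C$ arbitrary) be its recession cone, and put $[\emptyset]_\infty:=\{0\}$. Let $f:X\to\mathbb{R}\cup\{+\infty\}$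 be a convex function such that $\bar f$ is proper and $\operatorname{cl}([f\le 0])=[\operatorname{cl} f\le 0]$. Let $x\in[f\le 0]$ be such that $f(x)\in\mathbb{R}$. Then $$\mathrm{N}_{[f\le 0]}(x)=\Bigl[\operatorname{cl}\Bigl(\bigcup_{s>0,\ s f(x)\ge-\varepsilon}\partial_\varepsilon(s f)(x)\Bigr)\Bigr]_\infty\qquad\text{for all }\varepsilon>0,$$ and, consequently, $$\mathrm{N}_{[f\le 0]}(x)=\bigcap_{\varepsilon>0}\operatorname{cl}\Bigl(\bigcup_{s>0,\ s f(x)\ge-\varepsilon}\partial_\varepsilon(s f)(x)\Bigr).$$ -/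

import Mathlib

open Set Topology

namespace ConvexSublevel

noncomputable section

/-- The epigraph of `f : X → [-∞, +∞]`, as a subset of `X × ℝ`. -/
def epigraph {X : Type*} (f : X → EReal) : Set (X × ℝ) :=
  {p | f p.1 ≤ (p.2 : EReal)}

/-- The sublevel set `[f ≤ c]`. -/
def sublevel {X : Type*} (f : X → EReal) (c : ℝ) : Set X :=
  {x | f x ≤ (c : EReal)}

/-- `f` is convex if its epigraph is a convex set. -/
def IsConvexFun {X : Type*} [AddCommGroup X] [Module ℝ X] (f : X → EReal) : Prop :=
  Convex ℝ (epigraph f)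

/-- `f` is proper if its domain is nonempty and it never takes the value `-∞`. -/
def IsProper {X : Type*} (f : X → EReal) : Prop :=
  (∃ x, f x < ⊤) ∧ ∀ x, ⊥ < f x

/-- The closed hull `cl f` of `f`: the function whose epigraph is the closure of the epigraph of
`f` (see `epigraph_closedHull`). -/
def closedHull {X : Type*} [TopologicalSpace X] (f : X → EReal) (x : X) : EReal :=
  sInf {a | ∃ r : ℝ, (x, r) ∈ closure (epigraph f) ∧ a = (r : EReal)}

theorem epigraph_closedHull {X : Type*} [TopologicalSpace X] (f : X → EReal) :
    epigraph (closedHull f) = closure (epigraph f) := by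
  have up : ∀ (x : X) (r c : ℝ), 0 ≤ c → (x, r) ∈ closure (epigraph f) →
      (x, r + c) ∈ closure (epigraph f) := by
    intro x r c hc h
    have hcont : Continuous (fun p : X × ℝ => (p.1, p.2 + c)) := by fun_prop
    refine map_mem_closure (f := fun p : X × ℝ => (p.1, p.2 + c)) hcont h ?_
    intro p hp
    exact le_trans (show f p.1 ≤ (p.2 : EReal) from hp) (by exact_mod_cast (by linarith))
  ext ⟨x, r⟩
  constructor
  · intro h
    have h' : closedHull f x ≤ (r : EReal) := h
    have key : ∀ s : ℝ, r < s → (x, s) ∈ closure (epigraph f) := by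
      intro s hs
      have hlt : closedHull f x < (s : EReal) := lt_of_le_of_lt h' (by exact_mod_cast hs)
      obtain ⟨a, ⟨t, ht, rfl⟩, hts⟩ := sInf_lt_iff.1 hlt
      have hts' : t < s := by exact_mod_cast hts
      have := up x t (s - t) (by linarith) ht
      simpa using this
    have hc : Continuous (fun s : ℝ => (x, s)) := by fun_prop
    have hr : r ∈ closure (Ioi r) := by simp [closure_Ioi]
    have := map_mem_closure hc hr (t := closure (epigraph f)) (fun s hs => key s hs)
    simpa using this
  · intro h
    have h' : closedHull f x ≤ (r : EReal) := sInf_le ⟨r, h, rfl⟩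
    exact h'

/-- The indicator function of `A`: `0` on `A` and `+∞` outside `A`. -/
def indicatorFun {X : Type*} (A : Set X) (x : X) : EReal :=
  open Classical in if x ∈ A then 0 else ⊤

/-- The positive multiple `s f`; it is only used for `s > 0`, where `s · (±∞) = ±∞`. -/
def posMul {X : Type*} (s : ℝ) (f : X → EReal) (x : X) : EReal :=
  (s : EReal) * f x

/-- The recession cone `⋂_{t > 0} t (A - a)`, with `a ∈ A` arbitrary, of a closed convex set `A`
(the intersection does not depend on `a`); by convention, the recession cone of `∅` is `{0}`. -/
def recessionCone {E : Type*} [AddCommGroup E] [Module ℝ E] (A : Set E) : Set E :=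
  {v | (A = ∅ → v = 0) ∧ ∀ a ∈ A, ∀ t : ℝ, 0 < t → ∃ b ∈ A, v = t • (b - a)}

section Dual

variable {X : Type*} [AddCommGroup X] [Module ℝ X] [TopologicalSpace X]

/-- The `ε`-subdifferential of `f` at `x`, a subset of the topological dual of `X`; it is empty
when `f x` is not finite. -/
def epsSubdiff (ε : ℝ) (f : X → EReal) (x : X) : Set (X →L[ℝ] ℝ) :=
  {u | f x ≠ ⊥ ∧ f x ≠ ⊤ ∧ ∀ y, ((u (y - x) : ℝ) : EReal) ≤ f y - f x + (ε : EReal)}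

/-- The normal cone to `A` at `x`: the exact subdifferential at `x` of the indicator of `A`. -/
def normalCone (A : Set X) (x : X) : Set (X →L[ℝ] ℝ) :=
  epsSubdiff 0 (indicatorFun A) x

/-- The union of the sets `∂_ε (s f) (x)` over all `s > 0` such that `s f(x) ≥ -ε`. -/
def scaledSubdiffUnion (ε : ℝ) (f : X → EReal) (x : X) : Set (X →L[ℝ] ℝ) :=
  {u | ∃ s : ℝ, 0 < s ∧ ((-ε : ℝ) : EReal) ≤ posMul s f x ∧ u ∈ epsSubdiff ε (posMul s f) x}

/-- A topology `τ` on the topological dual `X*` is compatible with the duality between `X` and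
`X*` if it is a locally convex vector space topology whose continuous linear functionals are
exactly the evaluations at points of `X` (such as the weak-* topology). -/
structure IsCompatibleDualTopology (τ : TopologicalSpace (X →L[ℝ] ℝ)) : Prop where
  isTopologicalAddGroup : @IsTopologicalAddGroup (X →L[ℝ] ℝ) τ _
  continuousSMul : @ContinuousSMul ℝ (X →L[ℝ] ℝ) _ _ τ
  locallyConvexSpace : @LocallyConvexSpace ℝ (X →L[ℝ] ℝ) _ _ _ _ τ
  continuous_iff : ∀ φ : (X →L[ℝ] ℝ) →ₗ[ℝ] ℝ,
    Continuous[τ, inferInstance] φ ↔ ∃ z : X, ∀ u : X →L[ℝ] ℝ, φ u = u z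

end Dual

end

end ConvexSublevel

namespace ConvexSublevel

/-! Let `U` be the union at level `ε`. Its members are at most `2ε` on `[f ≤ 0] - x`, and so are
their `τ`-limits; hence recession directions, and limits common to all `ε`, are normal. Conversely,
for `u ∈ U` and `v` normal, `u + t • v` lies in the closure of the convex set `U` as soon as no
evaluation at a point `z` separates them. If `v z ≤ 0`, `u` itself shows this. If `v z > 0`, the
open ray from `x` along `z` avoids `cl [f ≤ 0] = [cl f ≤ 0]`, and
`exists_mem_scaledSubdiffUnion_lt_apply` makes the support function of `U` infinite at `z`: a steep
segment starting below `(x, f x)` is separated from the closed epigraph. -/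

theorem exists_continuousLinear_minorant_of_segment_disjoint {X : Type*} [AddCommGroup X]
    [Module ℝ X] [TopologicalSpace X] [IsTopologicalAddGroup X] [ContinuousSMul ℝ X]
    [LocallyConvexSpace ℝ X] {E : Set (X × ℝ)} (hE : Convex ℝ E) {x z : X} {r a b : ℝ}
    (hr : (x, r) ∈ E) (har : a < r)
    (hdisj : ∀ l ∈ Icc (0 : ℝ) 1, (x + l • z, a + l * (b - a)) ∉ closure E) :
    ∃ w : X →L[ℝ] ℝ, (∀ p ∈ E, w (p.1 - x) ≤ p.2 - a) ∧ b - r < w z := by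
  have hK : IsCompact (segment ℝ (x, a) (x + z, b)) := by
    rw [segment_eq_image_lineMap]
    refine isCompact_Icc.image ?_
    exact AffineMap.lineMap_continuous
  have hKE : Disjoint (closure E) (segment ℝ (x, a) (x + z, b)) := by
    rw [Set.disjoint_right]
    intro p hp
    rw [segment_eq_image'] at hp
    obtain ⟨l, hl, rfl⟩ := hp
    simpa using hdisj l hl
  obtain ⟨φ, α, β, h₁, hαβ, h₂⟩ := geometric_hahn_banach_closed_compact hE.closure isClosed_closure
    (convex_segment _ _) hK hKE
  set w : X →L[ℝ] ℝ := φ.comp (ContinuousLinearMap.inl ℝ X ℝ) with hw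
  have hφ : ∀ y t, φ (y, t) = w y + t * φ (0, 1) := by
    intro y t
    have : ((y, t) : X × ℝ) = (y, 0) + t • (0, 1) := by simp
    rw [this, map_add, map_smul]
    simp [hw]
  have hE' : ∀ p ∈ E, φ p < α := fun p hp => h₁ p (subset_closure hp)
  have hx := hE' _ hr
  have h0 := h₂ _ (left_mem_segment ℝ _ _)
  have h1 := h₂ _ (right_mem_segment ℝ _ _)
  rw [hφ] at hx h0 h1
  rw [map_add] at h1
  set k := φ (0, 1) with hk
  -- The strictly separated points `(x, r)` and `(x, a)` lie on one vertical line, so the hyperplane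
  -- is not vertical and can be normalised to a graph.
  have hkneg : k < 0 := by nlinarith
  have hkpos : 0 < (-k)⁻¹ := by simpa using hkneg
  refine ⟨(-k)⁻¹ • w, ?_, ?_⟩
  · rintro ⟨y, t⟩ hp
    have := hE' _ hp
    rw [hφ] at this
    simp only [smul_apply, smul_eq_mul]
    rw [map_sub, inv_mul_le_iff₀ (by linarith)]
    nlinarith
  · simp only [smul_apply, smul_eq_mul]
    rw [lt_inv_mul_iff₀ (by linarith)]
    nlinarith

theorem mem_closure_of_forall_exists_le {E : Type*} [AddCommGroup E] [Module ℝ E]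
    [TopologicalSpace E] [IsTopologicalAddGroup E] [ContinuousSMul ℝ E] [LocallyConvexSpace ℝ E]
    {U : Set E} (hU : Convex ℝ U) {v : E}
    (h : ∀ φ : E →L[ℝ] ℝ, ∃ u ∈ U, φ v ≤ φ u) : v ∈ closure U := by
  by_contra hv
  obtain ⟨φ, α, h₁, h₂⟩ := geometric_hahn_banach_closed_point hU.closure isClosed_closure hv
  obtain ⟨u, hu, hle⟩ := h φ
  linarith [h₁ u (subset_closure hu)]

theorem add_mem_closure_of_forall_add_mem_closure {E : Type*} [AddCommGroup E]
    [TopologicalSpace E] [IsTopologicalAddGroup E] {U : Set E} {c : E}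
    (h : ∀ u ∈ U, u + c ∈ closure U) : ∀ a ∈ closure U, a + c ∈ closure U := by
  intro a ha
  have hc : Continuous (fun u : E => u + c) := by fun_prop
  simpa using map_mem_closure hc ha h

theorem mem_closure_of_forall_small_smul_add_mem {E : Type*} [AddCommGroup E] [Module ℝ E]
    [TopologicalSpace E] [IsTopologicalAddGroup E] [ContinuousSMul ℝ E]
    {U : Set E} {v w : E} {δ : ℝ} (hδ : 0 < δ)
    (h : ∀ s, 0 < s → s < δ → s • w + v ∈ closure U) : v ∈ closure U := by
  have hc : Continuous (fun s : ℝ => s • w + v) := by fun_prop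
  have h0 : (0 : ℝ) ∈ closure (Ioo 0 δ) := by
    rw [closure_Ioo hδ.ne]
    exact ⟨le_rfl, hδ.le⟩
  have := map_mem_closure hc h0 (t := closure U) (fun s hs => h s hs.1 hs.2)
  simpa using this

theorem exists_forall_lt_notMem_closure_epigraph {X : Type*} [TopologicalSpace X] {f : X → EReal} {x : X} {r : ℝ}
    (hr : f x = r) (h : ⊥ < closedHull f x) :
    ∃ c < r, ∀ t ≤ c, (x, t) ∉ closure (epigraph f) := by
  obtain ⟨c, -, hc⟩ := EReal.lt_iff_exists_real_btwn.1 h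
  have key : ∀ t ≤ c, (x, t) ∉ closure (epigraph f) := by
    intro t ht hmem
    rw [← epigraph_closedHull] at hmem
    have h1 : closedHull f x ≤ (t : EReal) := hmem
    have h2 : (t : EReal) ≤ c := by exact_mod_cast ht
    exact absurd (hc.trans_le (h1.trans h2)) (lt_irrefl _)
  refine ⟨c, ?_, key⟩
  by_contra! hrc
  exact key r hrc (subset_closure (by simp [epigraph, hr]))

/-! ### Normal cone and scaled subdifferentials in real terms -/

section

variable {X : Type*} [AddCommGroup X] [Module ℝ X] [TopologicalSpace X]

theorem mem_normalCone_iff {A : Set X} {x : X} (hx : x ∈ A) {u : X →L[ℝ] ℝ} :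
    u ∈ normalCone A x ↔ ∀ y ∈ A, u (y - x) ≤ 0 := by
  have hx0 : indicatorFun A x = 0 := by simp [indicatorFun, hx]
  constructor
  · rintro ⟨-, -, h⟩ y hy
    have := h y
    rw [hx0] at this
    simpa [indicatorFun, hy, -map_sub] using this
  · intro h
    refine ⟨by simp [hx0], by simp [hx0], fun y => ?_⟩
    rw [hx0]
    by_cases hy : y ∈ A
    · simpa [indicatorFun, hy, -map_sub] using h y hy
    · simp [indicatorFun, hy]

theorem mem_scaledSubdiffUnion_iff {f : X → EReal} (hf : ∀ y, f y ≠ ⊥) {x : X} {r : ℝ}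
    (hr : f x = r) {ε : ℝ} {u : X →L[ℝ] ℝ} :
    u ∈ scaledSubdiffUnion ε f x ↔ ∃ s : ℝ, 0 < s ∧ -ε ≤ s * r ∧
      ∀ p ∈ epigraph f, u (p.1 - x) ≤ s * p.2 - s * r + ε := by
  have hx (s : ℝ) : posMul s f x = ((s * r : ℝ) : EReal) := by simp [posMul, hr]
  constructor
  · rintro ⟨s, hs, hsr, -, -, h⟩
    rw [hx] at hsr
    refine ⟨s, hs, by exact_mod_cast hsr, ?_⟩
    rintro ⟨y, t⟩ (hp : f y ≤ t)
    have hy := h y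
    have hne : f y ≠ ⊤ := fun h => by simp [h] at hp
    lift f y to ℝ using ⟨hne, hf y⟩ with c hc
    rw [hx, posMul, ← hc] at hy
    have hy' : u (y - x) ≤ s * c - s * r + ε := by exact_mod_cast hy
    have hct : c ≤ t := by exact_mod_cast hp
    have := mul_le_mul_of_nonneg_left hct hs.le
    linarith
  · rintro ⟨s, hs, hsr, h⟩
    refine ⟨s, hs, by rw [hx]; exact_mod_cast hsr, by rw [hx]; exact EReal.coe_ne_bot _,
      by rw [hx]; exact EReal.coe_ne_top _, fun y => ?_⟩
    rw [hx]
    by_cases hne : f y = ⊤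
    · rw [posMul, hne, EReal.coe_mul_top_of_pos hs, EReal.top_sub_coe, EReal.top_add_coe]
      exact le_top
    · have key : ∀ c : ℝ, f y = c → u (y - x) ≤ s * c - s * r + ε := fun c hc =>
        h (y, c) (by simp [epigraph, hc])
      rw [posMul]
      lift f y to ℝ using ⟨hne, hf y⟩ with c hc
      exact_mod_cast key c rfl

theorem convex_scaledSubdiffUnion {f : X → EReal} (hf : ∀ y, f y ≠ ⊥) {x : X} {r : ℝ}
    (hr : f x = r) (ε : ℝ) : Convex ℝ (scaledSubdiffUnion ε f x) := by
  intro u hu v hv a b ha hb hab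
  rw [mem_scaledSubdiffUnion_iff hf hr] at hu hv ⊢
  obtain ⟨s, hs, hsr, h⟩ := hu
  obtain ⟨s', hs', hsr', h'⟩ := hv
  obtain rfl : b = 1 - a := by linarith
  refine ⟨a * s + (1 - a) * s', ?_, by nlinarith, fun p hp => ?_⟩
  · rcases ha.eq_or_lt with rfl | ha
    · simpa using hs'
    · nlinarith [mul_pos ha hs, mul_nonneg hb hs'.le]
  · have h1 := mul_le_mul_of_nonneg_left (h p hp) ha
    have h2 := mul_le_mul_of_nonneg_left (h' p hp) hb
    simp only [add_apply, smul_apply, smul_eq_mul]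
    linarith

/-- One `ε` is the subgradient error, the other bounds `-s * r`. -/
theorem apply_sub_le_of_mem_scaledSubdiffUnion {f : X → EReal} (hf : ∀ y, f y ≠ ⊥) {x y : X}
    {r : ℝ} (hr : f x = r) {ε : ℝ} {u : X →L[ℝ] ℝ} (hu : u ∈ scaledSubdiffUnion ε f x)
    (hy : y ∈ sublevel f 0) : u (y - x) ≤ 2 * ε := by
  obtain ⟨s, hs, hsr, h⟩ := (mem_scaledSubdiffUnion_iff hf hr).1 hu
  have := h (y, 0) hy
  simp only [mul_zero] at this
  linarith

theorem apply_sub_le_of_mem_closure_scaledSubdiffUnion {τ : TopologicalSpace (X →L[ℝ] ℝ)}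
    (hτ : IsCompatibleDualTopology τ) {f : X → EReal} (hf : ∀ y, f y ≠ ⊥) {x y : X}
    {r : ℝ} (hr : f x = r) {ε : ℝ} {u : X →L[ℝ] ℝ}
    (hu : u ∈ closure[τ] (scaledSubdiffUnion ε f x))
    (hy : y ∈ sublevel f 0) : u (y - x) ≤ 2 * ε := by
  let φ : (X →L[ℝ] ℝ) →ₗ[ℝ] ℝ :=
    { toFun := fun u => u (y - x), map_add' := fun _ _ => rfl, map_smul' := fun _ _ => rfl }
  have hφ : Continuous[τ, inferInstance] φ := (hτ.continuous_iff φ).2 ⟨y - x, fun _ => rfl⟩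
  have hclosed : IsClosed[τ] (φ ⁻¹' Iic (2 * ε)) :=
    @IsClosed.preimage _ _ τ _ _ hφ _ isClosed_Iic
  have hsub : scaledSubdiffUnion ε f x ⊆ φ ⁻¹' Iic (2 * ε) :=
    fun w hw => apply_sub_le_of_mem_scaledSubdiffUnion hf hr hw hy
  exact @closure_minimal _ τ _ _ hsub hclosed _ hu

/-! ### Members of the union obtained by separation -/

variable [IsTopologicalAddGroup X] [ContinuousSMul ℝ X] [LocallyConvexSpace ℝ X]

theorem exists_small_smul_mem_scaledSubdiffUnion {f : X → EReal} (hf : ∀ y, f y ≠ ⊥)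
    (hconv : IsConvexFun f) {x : X} {r : ℝ} (hr : f x = r)
    (hcl : ⊥ < closedHull f x) {ε : ℝ} (hε : 0 < ε) :
    ∃ (w : X →L[ℝ] ℝ) (δ : ℝ), 0 < δ ∧
      ∀ s, 0 < s → s < δ → s • w ∈ scaledSubdiffUnion ε f x := by
  obtain ⟨c, hcr, hc⟩ := exists_forall_lt_notMem_closure_epigraph hr hcl
  obtain ⟨w, hw, -⟩ := exists_continuousLinear_minorant_of_segment_disjoint (z := 0) (b := c)
    hconv (x := x) (r := r) (by simp [epigraph, hr]) hcr (by simpa using fun _ _ _ => hc c le_rfl)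
  have hpos : 0 < |r| + (r - c) := add_pos_of_nonneg_of_pos (abs_nonneg r) (by linarith)
  -- The term `|r|` secures `-ε ≤ s * r`; `r - c` is the gap at `x` of the minorant, which must stay
  -- below `ε` after scaling.
  refine ⟨w, ε / (|r| + (r - c)), by positivity, fun s hs hsδ => ?_⟩
  rw [lt_div_iff₀ hpos] at hsδ
  have h1 : 0 ≤ s * |r| := by positivity
  have h2 : 0 ≤ s * (r - c) := mul_nonneg hs.le (by linarith)
  rw [mem_scaledSubdiffUnion_iff hf hr]
  refine ⟨s, hs, ?_, fun p hp => ?_⟩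
  · nlinarith [mul_le_mul_of_nonneg_left (neg_abs_le r) hs.le]
  · have := mul_le_mul_of_nonneg_left (hw p hp) hs.le
    simp only [smul_apply, smul_eq_mul]
    nlinarith

/-- The segment starts `ε / s` below `(x, r)` and rises by `M / s`; multiplying the separating
minorant by `s` turns its gap into `ε`. -/
theorem exists_mem_scaledSubdiffUnion_lt_apply_of_disjoint {f : X → EReal} (hf : ∀ y, f y ≠ ⊥)
    (hconv : IsConvexFun f) {x z : X} {r : ℝ} (hr : f x = r) {ε s M : ℝ} (hε : 0 < ε)
    (hs : 0 < s) (hsr : -ε ≤ s * r)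
    (hdisj : ∀ l ∈ Icc (0 : ℝ) 1, ∀ t, s * t = s * r - ε + l * M →
      (x + l • z, t) ∉ closure (epigraph f)) :
    ∃ w ∈ scaledSubdiffUnion ε f x, M - ε < w z := by
  have hεs : 0 < ε / s := by positivity
  obtain ⟨w, hw, hwz⟩ := exists_continuousLinear_minorant_of_segment_disjoint (z := z)
    (a := r - ε / s) (b := r - ε / s + M / s)
    hconv (x := x) (r := r) (by simp [epigraph, hr]) (by linarith)
    (fun l hl => hdisj l hl _ (by field_simp; ring))
  refine ⟨s • w, (mem_scaledSubdiffUnion_iff hf hr).2 ⟨s, hs, hsr, fun p hp => ?_⟩, ?_⟩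
  · have := mul_le_mul_of_nonneg_left (hw p hp) hs.le
    have e : s * (p.2 - (r - ε / s)) = s * p.2 - s * r + ε := by field_simp; ring
    simpa [← e] using this
  · have := mul_lt_mul_of_pos_left hwz hs
    have e : s * (r - ε / s + M / s - r) = M - ε := by field_simp; ring
    simpa [← e] using this

/-- The support function of `scaledSubdiffUnion ε f x` is infinite in every direction along which
the closed hull of `f` is positive. -/
theorem exists_mem_scaledSubdiffUnion_lt_apply {f : X → EReal} (hf : ∀ y, f y ≠ ⊥)
    (hconv : IsConvexFun f) {x z : X} {r : ℝ} (hr : f x = r) (hr0 : r ≤ 0)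
    (hcl : ⊥ < closedHull f x) {ε : ℝ} (hε : 0 < ε)
    (hz : ∀ l > (0 : ℝ), ∀ t, (x + l • z, t) ∈ closure (epigraph f) → 0 < t) (M : ℝ) :
    ∃ w ∈ scaledSubdiffUnion ε f x, M < w z := by
  suffices H : ∀ M : ℝ, 0 < M → ∃ w ∈ scaledSubdiffUnion ε f x, M - ε < w z by
    obtain ⟨w, hw, hlt⟩ := H (|M| + ε) (by positivity)
    exact ⟨w, hw, by linarith [le_abs_self M]⟩
  intro M hM
  have hE : Convex ℝ (closure (epigraph f)) := Convex.closure hconv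
  have comb : ∀ q l t m : ℝ, (x, q) ∈ closure (epigraph f) →
      (x + l • z, t) ∈ closure (epigraph f) → 0 ≤ m → m ≤ 1 →
      (x + (m * l) • z, q + m * (t - q)) ∈ closure (epigraph f) := by
    intro q l t m h1 h2 hm hm1
    have := hE h1 h2 (sub_nonneg.2 hm1) hm (by ring)
    convert this using 1
    ext
    · simp only [Prod.smul_mk, Prod.mk_add_mk]
      module
    · simp only [Prod.smul_mk, Prod.mk_add_mk, smul_eq_mul]
      ring
  by_cases hq : ∃ q < 0, (x, q) ∈ closure (epigraph f)
  · obtain ⟨q, hq0, hq⟩ := hq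
    obtain ⟨c, hcr, hc⟩ := exists_forall_lt_notMem_closure_epigraph hr hcl
    have hpos : 0 < -r + (r - c) + 1 := by linarith
    -- Small enough that `-ε ≤ s * r` and `r - ε / s ≤ c`, so the segment starts below the closed
    -- epigraph.
    set s := ε / (-r + (r - c) + 1) with hs_def
    have hs : 0 < s := by positivity
    have hsε : s * (-r + (r - c) + 1) = ε := by rw [hs_def]; field_simp
    have h1 : 0 ≤ s * (-r) := mul_nonneg hs.le (by linarith)
    have h2 : 0 ≤ s * (r - c) := mul_nonneg hs.le (by linarith)
    refine exists_mem_scaledSubdiffUnion_lt_apply_of_disjoint hf hconv hr hε hs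
      (by nlinarith) fun l hl t ht hmem => ?_
    rcases hl.1.eq_or_lt with rfl | hl0
    · refine hc t ?_ (by simpa using hmem)
      refine le_of_mul_le_mul_left ?_ hs
      nlinarith
    · have ht0 := hz l hl0 t hmem
      -- The chord from `(x, q)` to `(x + l • z, t)` would reach height `0` at this parameter,
      -- against `hz`: nothing of the closed epigraph lies over the open ray.
      have hm : 0 < -q / (t - q) := div_pos (by linarith) (by linarith)
      have := hz _ (mul_pos hm hl0) _ (comb q l t (-q / (t - q)) hq hmem hm.le
        (by rw [div_le_one (by linarith)]; linarith))
      rw [div_mul_cancel₀ _ (by linarith)] at this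
      linarith
  · push Not at hq
    have hxr : (x, r) ∈ closure (epigraph f) := subset_closure (by simp [epigraph, hr])
    obtain rfl : r = 0 := le_antisymm hr0 (not_lt.1 fun h => hq r h hxr)
    -- The segment reaches height `0` exactly at `l = δ`; up to there positivity of the hull
    -- suffices.
    set δ := ε / M with hδ_def
    have hδ : 0 < δ := by positivity
    have hδM : δ * M = ε := by rw [hδ_def]; field_simp
    obtain ⟨c, hc0, hc⟩ : ∃ c > (0 : ℝ), ∀ t, (x + δ • z, t) ∈ closure (epigraph f) → c ≤ t := by
      have hnm : (x + δ • z, (0 : ℝ)) ∉ epigraph (closedHull f) := by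
        rw [epigraph_closedHull]
        exact fun h => lt_irrefl _ (hz δ hδ 0 h)
      have hlt : ((0 : ℝ) : EReal) < closedHull f (x + δ • z) := not_le.1 hnm
      obtain ⟨c, h0c, hc⟩ := EReal.lt_iff_exists_real_btwn.1 hlt
      refine ⟨c, by exact_mod_cast h0c, fun t ht => ?_⟩
      rw [← epigraph_closedHull] at ht
      exact_mod_cast hc.le.trans ht
    have hs : 0 < ε / c := by positivity
    have hsc : ε / c * c = ε := by field_simp
    refine exists_mem_scaledSubdiffUnion_lt_apply_of_disjoint hf hconv hr hε hs
      (by linarith) fun l hl t ht hmem => ?_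
    rcases hl.1.eq_or_lt with rfl | hl0
    · refine hq t ?_ (by simpa using hmem)
      by_contra! h
      linarith [mul_nonneg hs.le h]
    · have ht0 := hz l hl0 t hmem
      have hst := mul_pos hs ht0
      have hlδ : δ < l := by
        by_contra! h
        linarith [mul_le_mul_of_nonneg_right h hM.le]
      -- Beyond `δ`, convexity from `(x, 0)` gives `t ≥ c * l / δ`, hence `s * t ≥ l * M` for `s = ε
      -- / c`, above the segment.
      have h1 := comb 0 l t (δ / l) hxr hmem (by positivity) ((div_le_one hl0).2 hlδ.le)
      rw [div_mul_cancel₀ _ hl0.ne'] at h1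
      have h2 := hc _ h1
      have h3 : c * l ≤ δ * t := by
        have h4 : δ / l * t = δ * t / l := by ring
        rw [zero_add, sub_zero, h4, le_div_iff₀ hl0] at h2
        exact h2
      have h5 := mul_le_mul_of_nonneg_left h3 hs.le
      have h6 : ε / c * (c * l) = ε * l := by rw [← mul_assoc, hsc]
      have h7 : ε / c * (δ * t) = δ * (ε / c * t) := by ring
      rw [h6, h7, ht] at h5
      have h8 : δ * (ε / c * 0 - ε + l * M) = ε * l - δ * ε := by rw [← hδM]; ring
      linarith [mul_pos hδ hε]

theorem smul_add_mem_closure_scaledSubdiffUnion {τ : TopologicalSpace (X →L[ℝ] ℝ)}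
    (hτ : IsCompatibleDualTopology τ) {f : X → EReal} (hf : ∀ y, f y ≠ ⊥)
    (hconv : IsConvexFun f) (hf_cl : closure (sublevel f 0) = sublevel (closedHull f) 0)
    {x : X} {r : ℝ} (hr : f x = r) (hr0 : r ≤ 0) (hcl : ⊥ < closedHull f x) {ε : ℝ} (hε : 0 < ε)
    {u v : X →L[ℝ] ℝ} (hu : u ∈ scaledSubdiffUnion ε f x)
    (hv : v ∈ normalCone (sublevel f 0) x) {t : ℝ} (ht : 0 ≤ t) :
    u + t • v ∈ closure[τ] (scaledSubdiffUnion ε f x) := by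
  have hx : x ∈ sublevel f 0 := by
    simpa [sublevel, hr] using hr0
  rw [mem_normalCone_iff hx] at hv
  refine @mem_closure_of_forall_exists_le _ _ _ τ hτ.isTopologicalAddGroup hτ.continuousSMul
    hτ.locallyConvexSpace _ (convex_scaledSubdiffUnion hf hr ε) _ fun φ => ?_
  obtain ⟨z, hz⟩ := (hτ.continuous_iff φ.toLinearMap).1 φ.cont
  replace hz : ∀ w, φ w = w z := hz
  simp only [hz]
  rcases le_or_gt (v z) 0 with h | h
  · refine ⟨u, hu, ?_⟩
    simpa using mul_nonpos_of_nonneg_of_nonpos ht h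
  · have hpos : ∀ l > (0 : ℝ), ∀ q, (x + l • z, q) ∈ closure (epigraph f) → 0 < q := by
      intro l hl q hq
      by_contra! hq0
      rw [← epigraph_closedHull] at hq
      have hmem : x + l • z ∈ closure (sublevel f 0) := by
        rw [hf_cl]
        exact le_trans (show closedHull f (x + l • z) ≤ (q : EReal) from hq)
          (by exact_mod_cast hq0)
      have hclosed : IsClosed {y : X | v (y - x) ≤ 0} :=
        isClosed_le (by fun_prop) continuous_const
      have hle : v (x + l • z - x) ≤ 0 := closure_minimal (fun y hy => hv y hy) hclosed hmem
      rw [add_sub_cancel_left, map_smul, smul_eq_mul] at hle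
      linarith [mul_pos hl h]
    obtain ⟨w, hw, hlt⟩ := exists_mem_scaledSubdiffUnion_lt_apply hf hconv hr hr0 hcl hε
      hpos ((u + t • v) z)
    exact ⟨w, hw, hlt.le⟩

end

end ConvexSublevel

/-! ### The two formulas for the normal cone -/

open ConvexSublevel in
theorem mainTheorem11 {X : Type*} [AddCommGroup X] [Module ℝ X] [TopologicalSpace X]
    [IsTopologicalAddGroup X] [ContinuousSMul ℝ X] [LocallyConvexSpace ℝ X]
    (τ : TopologicalSpace (X →L[ℝ] ℝ)) (hτ : IsCompatibleDualTopology τ)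
    (f : X → EReal) (hf_bot : ∀ y, f y ≠ ⊥) (hf_conv : IsConvexFun f)
    (hf_proper : IsProper (closedHull f))
    (hf_cl : closure (sublevel f 0) = sublevel (closedHull f) 0)
    (x : X) (hx : x ∈ sublevel f 0) (hfx : ∃ r : ℝ, f x = (r : EReal)) :
    (∀ ε : ℝ, 0 < ε →
      normalCone (sublevel f 0) x = recessionCone (closure[τ] (scaledSubdiffUnion ε f x))) ∧
    normalCone (sublevel f 0) x =
      ⋂ (ε : ℝ) (_ : 0 < ε), closure[τ] (scaledSubdiffUnion ε f x) := by
  obtain ⟨r, hr⟩ := hfx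
  have hr0 : r ≤ 0 := by
    have : f x ≤ ((0 : ℝ) : EReal) := hx
    rw [hr] at this
    exact_mod_cast this
  have hcl := hf_proper.2 x
  have htg := hτ.isTopologicalAddGroup
  have hsm := hτ.continuousSMul
  have hsub : ∀ ε : ℝ, scaledSubdiffUnion ε f x ⊆ closure[τ] (scaledSubdiffUnion ε f x) :=
    fun ε => @subset_closure _ τ _
  constructor
  · intro ε hε
    obtain ⟨w, δ, hδ, hw⟩ := exists_small_smul_mem_scaledSubdiffUnion hf_bot hf_conv hr hcl hε
    have hw0 := hw (δ / 2) (by linarith) (by linarith)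
    ext v
    constructor
    · intro hv
      refine ⟨fun h => ?_, fun a ha t ht => ?_⟩
      · exact absurd (hsub ε hw0) (by simp [h])
      · refine ⟨a + t⁻¹ • v, ?_, ?_⟩
        · exact @add_mem_closure_of_forall_add_mem_closure _ _ τ htg _ _
            (fun u hu => smul_add_mem_closure_scaledSubdiffUnion hτ hf_bot hf_conv hf_cl hr hr0
              hcl hε hu hv (inv_nonneg.2 ht.le)) a ha
        · simp [smul_smul, ht.ne']
    · rintro ⟨-, h⟩
      rw [mem_normalCone_iff hx]
      intro y hy
      by_contra! hpos
      -- A half-line in direction `v` stays in the closure, where evaluation at `y - x` is bounded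
      -- above.
      have bound : ∀ t : ℝ, 0 < t → ((δ / 2) • w) (y - x) + t * v (y - x) ≤ 2 * ε := by
        intro t ht
        obtain ⟨b, hb, hvb⟩ := h _ (hsub ε hw0) t⁻¹ (inv_pos.2 ht)
        have hb' := apply_sub_le_of_mem_closure_scaledSubdiffUnion hτ hf_bot hr hb hy
        have e : t • v = b - (δ / 2) • w := by rw [hvb, smul_smul, mul_inv_cancel₀ ht.ne', one_smul]
        have e' := congrArg (fun u : X →L[ℝ] ℝ => u (y - x)) e
        simp only [smul_apply, sub_apply,
          smul_eq_mul] at e' ⊢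
        linarith
      set k := ((δ / 2) • w) (y - x)
      have := bound ((|2 * ε - k| + 1) / v (y - x)) (by positivity)
      rw [div_mul_cancel₀ _ hpos.ne'] at this
      linarith [le_abs_self (2 * ε - k)]
  · ext v
    simp only [mem_iInter]
    constructor
    · intro hv ε hε
      obtain ⟨w, δ, hδ, hw⟩ := exists_small_smul_mem_scaledSubdiffUnion hf_bot hf_conv hr hcl hε
      -- `v` is the limit of `s • w + v` as `s` decreases to `0`.
      refine @mem_closure_of_forall_small_smul_add_mem _ _ _ τ htg hsm _ _ w _ hδ
        fun s hs hsδ => ?_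
      simpa using smul_add_mem_closure_scaledSubdiffUnion hτ hf_bot hf_conv hf_cl hr hr0
        hcl hε (hw s hs hsδ) hv zero_le_one
    · intro h
      rw [mem_normalCone_iff hx]
      intro y hy
      refine le_of_forall_pos_le_add fun ε hε => ?_
      have := apply_sub_le_of_mem_closure_scaledSubdiffUnion hτ hf_bot hr
        (h (ε / 2) (by linarith)) hy
      linarith
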